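/- For a nonzero (possibly multivariate) polynomial $p$ over $\mathbb{C}$, let $r(p)$ denote the degree of its square-free part, i.e. $r(p)=\deg(p_1\cdots p_s)$ if $p = c\,p_1^{e_1}\cdots p_s^{e_s}$ with $c\in\mathbb{C}^*$, the $p_i$ irreducible and pairwise relatively prime, and all $e_i\ge 1$; here $\deg$ is the total degree. Call two polynomials $p, q$ similar if $q=\lambda p$ for some $\lambda\in\mathbb{C}^*$. Let $f_1,f_2,\dots,f_n$ be nonzero polynomials over $\mathbb{C}$ in finitely many variables, not all similar to each other, such that $$f_1+f_2+\cdots+f_n=0 .$$ Assume furthermore that for all $1\le i_1<i_2<\cdots<i_s\le n$ (with $s\ge 1$), $$f_{i_1}+f_{i_2}+\cdots+f_{i_s}=0 \;\Longrightarrow\; \deg\gcd\{f_{i_1},f_{i_2},\dots,f_{i_s}\}\le \deg f_n .$$ Let $d$ be the dimension of the vector space over $\mathbb{C}$ spanned by $f_1,\dots,f_n$, and let $k$ be the number of indices $i$ for which $f_i$ is constant. Then for every integer $d'$ with $d\le d'\le n-k$, $$\max_{1\le m\le n-1}\deg f_m-\deg f_n\;\le\;(d'-1)\left(r(f_1)+r(f_2)+\cdots+r(f_{n-1})-\frac{d'}{2}\right).$$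 Furthermore, for any such $d'$, equality is only possible if $\gcd\{f_1,f_2,\dots,f_n\}=1$. -/

import Mathlib

/-- Greatest common divisors in `ℂ[x₁, …, x_l]`, a unique factorization domain. A representative of
each class of associated polynomials is chosen; it is `1` for the class of nonzero constants. -/
noncomputable instance mvPolynomialNormalizedGCDMonoid (l : ℕ) :
    NormalizedGCDMonoid (MvPolynomial (Fin l) ℂ) :=
  letI : NormalizationMonoid (MvPolynomial (Fin l) ℂ) :=
    UniqueFactorizationMonoid.strongNormalizationMonoid.toNormalizationMonoid
  UniqueFactorizationMonoid.toNormalizedGCDMonoid (MvPolynomial (Fin l) ℂ)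

/-- `r(p)`: the degree of the square-free part of `p`, i.e. of the product of the pairwise
non-associated irreducible factors of `p`. -/
noncomputable def radicalDegree {l : ℕ} (p : MvPolynomial (Fin l) ℂ) : ℕ :=
  (UniqueFactorizationMonoid.radical p).totalDegree

/-- `p` and `q` are similar if `q = c p` for some nonzero complex number `c`. -/
def PolySimilar {l : ℕ} (p q : MvPolynomial (Fin l) ℂ) : Prop :=
  ∃ c : ℂ, c ≠ 0 ∧ q = MvPolynomial.C c * p

/-- The number of constant polynomials in a finite family (counted with multiplicity). -/
noncomputable def numConstants {N l : ℕ} (f : Fin N → MvPolynomial (Fin l) ℂ) : ℕ :=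
  {i : Fin N | ∃ c : ℂ, f i = MvPolynomial.C c}.ncard

/-- The dimension of the complex vector space spanned by a finite family of polynomials. -/
noncomputable def spanDim {N l : ℕ} (f : Fin N → MvPolynomial (Fin l) ℂ) : ℕ :=
  Module.finrank ℂ (Submodule.span ℂ (Set.range f))

open MvPolynomial

section IteratedPartialDerivatives

variable {σ k : Type*} [Field k]

/-- The iterated partial derivative of `f` along the word `w`. -/
noncomputable def iterPDeriv (w : List σ) (f : MvPolynomial σ k) : MvPolynomial σ k :=
  w.foldr (fun i g => pderiv i g) f

@[simp] theorem iterPDeriv_nil (f : MvPolynomial σ k) : iterPDeriv [] f = f := rfl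

@[simp] theorem iterPDeriv_cons (i : σ) (w : List σ) (f : MvPolynomial σ k) :
    iterPDeriv (i :: w) f = pderiv i (iterPDeriv w f) := rfl

theorem iterPDeriv_sum_C_mul {ι : Type*} (s : Finset ι) (w : List σ) (a : ι → k)
    (f : ι → MvPolynomial σ k) :
    iterPDeriv w (∑ i ∈ s, C (a i) * f i) = ∑ i ∈ s, C (a i) * iterPDeriv w (f i) := by
  induction w with
  | nil => rfl
  | cons j w ih => simp [ih]

theorem pderiv_eq_zero_or_totalDegree_add_one_le (i : σ) (f : MvPolynomial σ k) :
    pderiv i f = 0 ∨ (pderiv i f).totalDegree + 1 ≤ f.totalDegree := by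
  by_cases h : pderiv i f = 0
  · exact Or.inl h
  right
  have hs : (pderiv i f).support.Nonempty := support_nonempty.mpr h
  obtain ⟨m, hm, hmd⟩ := Finset.exists_mem_eq_sup (pderiv i f).support hs
    (fun m => m.sum fun _ e => e)
  have hc : m + Finsupp.single i 1 ∈ f.support := by
    rw [mem_support_iff, coeff_pderiv] at hm
    rw [mem_support_iff]
    exact left_ne_zero_of_mul hm
  have hle := le_totalDegree hc
  rw [Finsupp.sum_add_index' (fun _ => rfl) (fun _ _ _ => rfl),
    Finsupp.sum_single_index rfl] at hle
  rw [totalDegree, hmd]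
  exact hle

theorem iterPDeriv_eq_zero_or_totalDegree_add_length_le (w : List σ) (f : MvPolynomial σ k) :
    iterPDeriv w f = 0 ∨ (iterPDeriv w f).totalDegree + w.length ≤ f.totalDegree := by
  induction w with
  | nil => simp
  | cons i w ih =>
    rcases ih with ih | ih
    · simp [ih]
    · rcases pderiv_eq_zero_or_totalDegree_add_one_le i (iterPDeriv w f) with h | h
      · exact Or.inl h
      · right
        simp only [iterPDeriv_cons, List.length_cons]
        omega

theorem eq_C_of_pderiv_eq_zero [CharZero k] {f : MvPolynomial σ k}
    (h : ∀ i, pderiv i f = 0) : ∃ a, f = C a := by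
  classical
  refine ⟨coeff 0 f, MvPolynomial.ext _ _ fun m => ?_⟩
  rw [coeff_C]
  split_ifs with hm
  · rw [← hm]
  obtain ⟨i, hi⟩ : ∃ i, m i ≠ 0 := by
    by_contra! hc
    exact hm (Finsupp.ext fun i => (hc i).symm)
  have h1 := congrArg (coeff (m - Finsupp.single i 1)) (h i)
  rw [coeff_pderiv, coeff_zero, tsub_add_cancel_of_le
    (Finsupp.single_le_iff.mpr (Nat.one_le_iff_ne_zero.mpr hi))] at h1
  refine (mul_eq_zero.mp h1).resolve_right ?_
  exact Nat.cast_add_one_ne_zero _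

/-- A polynomial divides its derivative times its radical. -/
theorem dvd_pderiv_mul_radical [NormalizationMonoid (MvPolynomial σ k)] (i : σ)
    (f : MvPolynomial σ k) :
    f ∣ pderiv i f * UniqueFactorizationMonoid.radical f := by
  induction f using UniqueFactorizationMonoid.induction_on_coprime with
  | h0 => simp
  | h1 hx => exact hx.dvd
  | hpr n hp =>
    rename_i p
    rcases Nat.eq_zero_or_pos n with rfl | hn
    · simp
    obtain ⟨m, rfl⟩ := Nat.exists_eq_add_of_lt hn
    have hr : p ∣ UniqueFactorizationMonoid.radical (p ^ (0 + m + 1)) := by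
      rw [UniqueFactorizationMonoid.radical_pow_of_prime hp (by omega)]
      exact (normalize_associated p).dvd'
    obtain ⟨q, hq⟩ := hr
    rw [hq, pderiv_pow]
    exact ⟨(0 + m + 1 : ℕ) * pderiv i p * q, by simp; ring⟩
  | hcp hxy hx hy =>
    rename_i x y
    obtain ⟨a, ha⟩ := hx
    obtain ⟨b, hb⟩ := hy
    rw [UniqueFactorizationMonoid.radical_mul hxy, pderiv_mul]
    refine ⟨a * UniqueFactorizationMonoid.radical y + b * UniqueFactorizationMonoid.radical x, ?_⟩
    linear_combination (y * UniqueFactorizationMonoid.radical y) * ha +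
      (x * UniqueFactorizationMonoid.radical x) * hb

theorem dvd_iterPDeriv_mul_radical_pow_length [NormalizationMonoid (MvPolynomial σ k)]
    (w : List σ) (f : MvPolynomial σ k) :
    f ∣ iterPDeriv w f * UniqueFactorizationMonoid.radical f ^ w.length := by
  induction w with
  | nil => simp
  | cons i w ih =>
    set r := UniqueFactorizationMonoid.radical f
    obtain ⟨q, hq⟩ := ih
    obtain ⟨a, ha⟩ := dvd_pderiv_mul_radical i f
    have h := congrArg (pderiv i) hq
    rw [pderiv_mul, pderiv_mul, pderiv_pow] at h
    simp only [iterPDeriv_cons, List.length_cons]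
    rcases Nat.eq_zero_or_pos w.length with h0 | h0
    · rw [h0] at h hq ⊢
      simp only [pow_zero, mul_one, Nat.cast_zero, zero_mul, mul_zero, add_zero] at h hq
      refine ⟨a * q + pderiv i q * r, ?_⟩
      change pderiv i f * r = f * a at ha
      linear_combination r * h + q * ha
    · obtain ⟨m, hm⟩ := Nat.exists_eq_add_of_lt h0
      rw [hm] at h hq ⊢
      simp only [zero_add, add_tsub_cancel_right] at h hq ⊢
      refine ⟨a * q + pderiv i q * r - (m + 1 : ℕ) * pderiv i r * q, ?_⟩
      change pderiv i f * r = f * a at ha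
      linear_combination r * h + q * ha - (m + 1 : ℕ) * pderiv i r * hq

theorem dvd_iterPDeriv_mul_radical_pow [NormalizationMonoid (MvPolynomial σ k)]
    {w : List σ} {M : ℕ} (hw : w.length ≤ M) (f : MvPolynomial σ k) :
    f ∣ iterPDeriv w f * UniqueFactorizationMonoid.radical f ^ M :=
  (dvd_iterPDeriv_mul_radical_pow_length w f).trans
    (mul_dvd_mul_left _ (pow_dvd_pow _ hw))

end IteratedPartialDerivatives

section GeneralizedWronskian

variable {σ k : Type*} [Field k]

/-- The matrix whose `(j, i)` entry is the derivative of `g i` along the word `w j`. -/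
noncomputable def jetMatrix {d : ℕ} (w : Fin d → List σ) (g : Fin d → MvPolynomial σ k) :
    Matrix (Fin d) (Fin d) (MvPolynomial σ k) :=
  Matrix.of fun j i => iterPDeriv (w j) (g i)

theorem prod_dvd_det_jetMatrix_mul [NormalizationMonoid (MvPolynomial σ k)] {d M : ℕ}
    {w : Fin d → List σ} (hw : ∀ j, (w j).length ≤ M) (g : Fin d → MvPolynomial σ k) :
    ∏ i, g i ∣ (jetMatrix w g).det * ∏ i, UniqueFactorizationMonoid.radical (g i) ^ M := by
  choose q hq using fun j i => dvd_iterPDeriv_mul_radical_pow (hw j) (g i)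
  refine ⟨(Matrix.of q).det, ?_⟩
  rw [mul_comm, ← Matrix.det_mul_row, ← Matrix.det_mul_row]
  congr 1
  ext1 j i
  simp only [Matrix.of_apply, jetMatrix]
  rw [← hq j i, mul_comm]

theorem totalDegree_det_jetMatrix_add_le {d : ℕ} (w : Fin d → List σ)
    (g : Fin d → MvPolynomial σ k) (h : (jetMatrix w g).det ≠ 0) :
    (jetMatrix w g).det.totalDegree + ∑ j, (w j).length ≤ ∑ i, (g i).totalDegree := by
  have key : ∀ τ : Equiv.Perm (Fin d), (∏ i, jetMatrix w g (τ i) i) = 0 ∨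
      (∏ i, jetMatrix w g (τ i) i).totalDegree + ∑ j, (w j).length ≤
        ∑ i, (g i).totalDegree := by
    intro τ
    by_cases h0 : ∏ i, jetMatrix w g (τ i) i = 0
    · exact Or.inl h0
    right
    rw [← ne_eq, Finset.prod_ne_zero_iff] at h0
    rw [← Equiv.sum_comp τ fun j => (w j).length]
    calc _ ≤ ∑ i, (jetMatrix w g (τ i) i).totalDegree + ∑ i, (w (τ i)).length :=
          Nat.add_le_add_right (totalDegree_finsetProd _ _) _
      _ = ∑ i, ((jetMatrix w g (τ i) i).totalDegree + (w (τ i)).length) :=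
          Finset.sum_add_distrib.symm
      _ ≤ _ := Finset.sum_le_sum fun i _ =>
          (iterPDeriv_eq_zero_or_totalDegree_add_length_le (w (τ i)) (g i)).resolve_left
            (h0 i (Finset.mem_univ i))
  have hle : ∑ j, (w j).length ≤ ∑ i, (g i).totalDegree := by
    by_contra hlt
    apply h
    rw [Matrix.det_apply]
    refine Finset.sum_eq_zero fun τ _ => ?_
    rcases key τ with h0 | h0
    · rw [h0, smul_zero]
    · omega
  suffices (jetMatrix w g).det.totalDegree ≤
      ∑ i, (g i).totalDegree - ∑ j, (w j).length by omega
  rw [Matrix.det_apply]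
  refine totalDegree_finsetSum_le fun τ _ => (totalDegree_smul_le _ _).trans ?_
  rcases key τ with h0 | h0
  · simp [h0]
  · omega

theorem det_jetMatrix_eq_C_mul {d : ℕ} (w : Fin d → List σ) {g b : Fin d → MvPolynomial σ k}
    (h : ∀ i, g i ∈ Submodule.span k (Set.range b)) :
    ∃ c, (jetMatrix w g).det = C c * (jetMatrix w b).det := by
  choose a ha using fun i => (Submodule.mem_span_range_iff_exists_fun k).mp (h i)
  refine ⟨(Matrix.of fun j i => a i j).det, ?_⟩
  rw [RingHom.map_det, mul_comm, ← Matrix.det_mul]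
  congr 1
  ext1 j i
  simp only [jetMatrix, Matrix.of_apply, Matrix.mul_apply, RingHom.mapMatrix_apply,
    Matrix.map_apply]
  rw [← ha i]
  simp only [smul_eq_C_mul]
  rw [iterPDeriv_sum_C_mul]
  exact Finset.sum_congr rfl fun _ _ => mul_comm _ _

end GeneralizedWronskian

section GapFreeBases

/-- If the spans of the vectors of order at most `s` strictly increase with `s` until they fill the
space, then there is a basis among the vectors whose orders leave no gaps. -/
theorem exists_linearIndependent_sum_order_ge {K V Θ : Type*} [Field K] [AddCommGroup V]
    [Module K V] [FiniteDimensional K V] {d : ℕ} (hd : Module.finrank K V = d) (r : Θ → V)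
    (o : Θ → ℕ) (θ₀ : Θ) (ho₀ : o θ₀ = 0) (hr₀ : r θ₀ ≠ 0)
    (hstep : ∀ s, Submodule.span K (r '' {θ | o θ ≤ s}) =
      Submodule.span K (r '' {θ | o θ ≤ s + 1}) →
      Submodule.span K (r '' {θ | o θ ≤ s}) = ⊤) :
    ∃ (M : ℕ) (w : Fin d → Θ), LinearIndependent K (r ∘ w) ∧ (∀ j, o (w j) ≤ M) ∧
      M * (M + 1) ≤ 2 * ∑ j, o (w j) ∧ M + 1 ≤ d ∧
      Submodule.span K (r '' {θ | o θ ≤ M}) = ⊤ := by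
  classical
  set S : ℕ → Submodule K V := fun s => Submodule.span K (r '' {θ | o θ ≤ s}) with hS
  have hmono : Monotone S := fun s t hst =>
    Submodule.span_mono (Set.image_mono fun θ (hθ : o θ ≤ s) => hθ.trans hst)
  have hex : ∃ M, S M = ⊤ := by
    obtain ⟨N, hN⟩ := monotone_stabilizes_iff_noetherian.mpr
      (inferInstance : IsNoetherian K V) ⟨S, hmono⟩
    exact ⟨N, hstep N (hN (N + 1) (Nat.le_succ N))⟩
  set M := Nat.find hex with hM
  have hMtop : S M = ⊤ := Nat.find_spec hex
  have hnew : ∀ s, s < M → ∃ θ, o θ = s + 1 ∧ r θ ∉ S s := by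
    intro s hs
    by_contra! hc
    refine Nat.find_min hex hs (hstep s (le_antisymm (hmono (Nat.le_succ s)) ?_))
    rw [Submodule.span_le]
    rintro _ ⟨θ, hθ, rfl⟩
    rcases Nat.lt_or_eq_of_le (show o θ ≤ s + 1 from hθ) with h | h
    · exact Submodule.subset_span ⟨θ, Nat.lt_succ_iff.mp h, rfl⟩
    · exact hc θ h
  have hex_t : ∃ t : ℕ → Θ, ∀ s ≤ M, o (t s) = s ∧ (∀ s', s = s' + 1 → r (t s) ∉ S s') ∧
      r (t s) ≠ 0 := by
    have : ∀ s, ∃ θ, s ≤ M → o θ = s ∧ (∀ s', s = s' + 1 → r θ ∉ S s') ∧ r θ ≠ 0 := by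
      intro s
      by_cases hs : s ≤ M
      · rcases s with _ | s
        · exact ⟨θ₀, fun _ => ⟨ho₀, by simp, hr₀⟩⟩
        · obtain ⟨θ, h1, h2⟩ := hnew s hs
          refine ⟨θ, fun _ => ⟨h1, fun s' h => ?_, fun h => h2 (h ▸ zero_mem _)⟩⟩
          obtain rfl : s = s' := by omega
          exact h2
      · exact ⟨θ₀, fun h => absurd h hs⟩
    choose t ht using this
    exact ⟨t, ht⟩
  obtain ⟨t, ht⟩ := hex_t
  have hind : ∀ m ≤ M, LinearIndepOn K r ((Finset.range (m + 1)).image t : Finset Θ) := by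
    intro m
    induction m with
    | zero =>
      intro _
      simpa using (ht 0 (Nat.zero_le M)).2.2
    | succ m ih =>
      intro hm
      rw [Finset.range_add_one, Finset.image_insert, Finset.coe_insert]
      refine (ih (by omega)).insert fun hmem => (ht (m + 1) hm).2.1 m rfl ?_
      refine Submodule.span_mono (Set.image_mono ?_) hmem
      intro θ hθ
      obtain ⟨s, hs, rfl⟩ := Finset.mem_image.mp (Finset.mem_coe.mp hθ)
      have hs' := Finset.mem_range.mp hs
      change o (t s) ≤ m
      rw [(ht s (by omega)).1]
      omega
  have hsub : ((Finset.range (M + 1)).image t : Set Θ) ⊆ {θ | o θ ≤ M} := by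
    intro θ hθ
    obtain ⟨s, hs, rfl⟩ := Finset.mem_image.mp (Finset.mem_coe.mp hθ)
    have hs' := Finset.mem_range.mp hs
    change o (t s) ≤ M
    rw [(ht s (by omega)).1]
    omega
  obtain ⟨b, hbM, htb, hspan, hb⟩ := exists_linearIndepOn_extension (hind M le_rfl) hsub
  have hbfin : b.Finite := by
    have : Finite b := hb.finite
    exact Set.toFinite b
  lift b to Finset Θ using hbfin
  have hbspan : Submodule.span K (Set.range fun i : b => r i) = ⊤ := by
    rw [eq_top_iff, ← hMtop]
    refine Submodule.span_le.mpr (hspan.trans_eq ?_)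
    congr 2
    rw [Set.image_eq_range]
    rfl
  have hcard : b.card = d := by
    have h := finrank_span_eq_card (show LinearIndependent K fun i : b => r i from hb)
    rw [hbspan, finrank_top, hd, Fintype.card_coe] at h
    exact h.symm
  have hinj : Set.InjOn t (Finset.range (M + 1)) := by
    intro s hs s' hs' h
    have hs := Finset.mem_range.mp (Finset.mem_coe.mp hs)
    have hs' := Finset.mem_range.mp (Finset.mem_coe.mp hs')
    rw [← (ht s (by omega)).1, ← (ht s' (by omega)).1, h]
  have htb' : (Finset.range (M + 1)).image t ⊆ b := Finset.coe_subset.mp htb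
  let e := (b.equivFinOfCardEq hcard).symm
  refine ⟨M, fun j => e j, ?_, fun j => hbM (e j).2, ?_, ?_, hMtop⟩
  · exact hb.comp e e.injective
  · have h1 : ∑ j, o (e j) = ∑ θ ∈ b, o θ := by
      rw [Equiv.sum_comp e fun θ : b => o θ, Finset.sum_coe_sort b o]
    have h2 : ∑ s ∈ Finset.range (M + 1), s ≤ ∑ θ ∈ b, o θ := by
      calc _ = ∑ s ∈ Finset.range (M + 1), o (t s) :=
            Finset.sum_congr rfl fun s hs =>
              ((ht s (Nat.lt_succ_iff.mp (Finset.mem_range.mp hs))).1).symm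
        _ = ∑ θ ∈ (Finset.range (M + 1)).image t, o θ := (Finset.sum_image hinj).symm
        _ ≤ _ := Finset.sum_le_sum_of_subset htb'
    have h3 := Finset.sum_range_id_mul_two (M + 1)
    simp only [add_tsub_cancel_right] at h3
    rw [h1]
    nlinarith
  · calc M + 1 = ((Finset.range (M + 1)).image t).card := by
          rw [Finset.card_image_of_injOn hinj, Finset.card_range]
      _ ≤ b.card := Finset.card_le_card htb'
      _ = d := hcard

end GapFreeBases

section GeneralizedWronskian

variable {σ k : Type*} [Field k]

theorem eq_zero_of_forall_sum_mul_iterPDeriv [CharZero k] {d : ℕ} {g : Fin d → MvPolynomial σ k}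
    (hg : LinearIndependent k g) (c : Fin d → MvPolynomial σ k)
    (hc : ∀ w, ∑ i, c i * iterPDeriv w (g i) = 0) : c = 0 := by
  obtain ⟨N, hN⟩ : ∃ N, ∀ i, (c i).totalDegree ≤ N :=
    ⟨Finset.univ.sup fun i => (c i).totalDegree, fun i =>
      Finset.le_sup (f := fun i => (c i).totalDegree) (Finset.mem_univ i)⟩
  have hconst : ∀ c : Fin d → MvPolynomial σ k, (∀ w, ∑ i, c i * iterPDeriv w (g i) = 0) →
      (∀ i, ∃ a, c i = C a) → c = 0 := by
    intro c hc ha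
    choose a ha using ha
    have h := hc []
    simp only [ha, ← smul_eq_C_mul, iterPDeriv_nil] at h
    funext i
    rw [ha, Fintype.linearIndependent_iff.mp hg a h i, C_0, Pi.zero_apply]
  induction N generalizing c with
  | zero => exact hconst c hc fun i => ⟨_, totalDegree_eq_zero_iff_eq_C.mp (Nat.le_zero.mp (hN i))⟩
  | succ N ih =>
    refine hconst c hc fun i => eq_C_of_pderiv_eq_zero fun x => ?_
    have h0 : (fun i => pderiv x (c i)) = 0 := by
      refine ih _ (fun w => ?_) fun i => ?_
      · have h1 := congrArg (pderiv x) (hc w)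
        have h2 := hc (x :: w)
        simp only [map_sum, pderiv_mul, map_zero, Finset.sum_add_distrib] at h1
        simp only [iterPDeriv_cons] at h2
        rwa [h2, add_zero] at h1
      · rcases pderiv_eq_zero_or_totalDegree_add_one_le x (c i) with h | h
        · simp [h]
        · have := hN i
          omega
    exact congrFun h0 i

theorem forall_sum_mul_iterPDeriv_eq_zero_of_step {d s : ℕ} {g : Fin d → MvPolynomial σ k}
    (hstep : ∀ c : Fin d → MvPolynomial σ k,
      (∀ w : List σ, w.length ≤ s → ∑ i, c i * iterPDeriv w (g i) = 0) →
      ∀ w : List σ, w.length ≤ s + 1 → ∑ i, c i * iterPDeriv w (g i) = 0)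
    (c : Fin d → MvPolynomial σ k)
    (hc : ∀ w : List σ, w.length ≤ s → ∑ i, c i * iterPDeriv w (g i) = 0) (w : List σ) :
    ∑ i, c i * iterPDeriv w (g i) = 0 := by
  induction w generalizing c with
  | nil => exact hc [] (Nat.zero_le s)
  | cons x w ih =>
    have hder : ∀ w : List σ, w.length ≤ s → ∑ i, pderiv x (c i) * iterPDeriv w (g i) = 0 := by
      intro w hw
      have h1 := congrArg (pderiv x) (hc w hw)
      have h2 := hstep c hc (x :: w) (by simpa using hw)
      simp only [map_sum, pderiv_mul, map_zero, Finset.sum_add_distrib] at h1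
      simp only [iterPDeriv_cons] at h2
      rwa [h2, add_zero] at h1
    have h1 := congrArg (pderiv x) (ih c hc)
    simp only [map_sum, pderiv_mul, map_zero, Finset.sum_add_distrib] at h1
    rw [ih _ hder, zero_add] at h1
    simpa using h1

/-- Linearly independent polynomials have a nonzero generalized Wronskian in which the orders of
the derivations leave no gaps. -/
theorem exists_det_jetMatrix_ne_zero [CharZero k] {d : ℕ} (hd : 2 ≤ d)
    {g : Fin d → MvPolynomial σ k} (hg : LinearIndependent k g) :
    ∃ (M : ℕ) (w : Fin d → List σ), (jetMatrix w g).det ≠ 0 ∧ (∀ j, (w j).length ≤ M) ∧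
      M * (M + 1) ≤ 2 * ∑ j, (w j).length ∧ 1 ≤ M ∧ M + 1 ≤ d := by
  classical
  let K := FractionRing (MvPolynomial σ k)
  let r : List σ → Fin d → K := fun w i => algebraMap _ K (iterPDeriv w (g i))
  have hinj : Function.Injective (algebraMap (MvPolynomial σ k) K) := IsFractionRing.injective _ _
  have hstep : ∀ s, Submodule.span K (r '' {w | w.length ≤ s}) =
      Submodule.span K (r '' {w | w.length ≤ s + 1}) →
      Submodule.span K (r '' {w | w.length ≤ s}) = ⊤ := by
    intro s hs
    have hker : ∀ c : Fin d → MvPolynomial σ k, ∀ t,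
        (∀ w : List σ, w.length ≤ t → ∑ i, c i * iterPDeriv w (g i) = 0) ↔
        Submodule.span K (r '' {w | w.length ≤ t}) ≤ LinearMap.ker
          (∑ i, algebraMap _ K (c i) • (LinearMap.proj i : (Fin d → K) →ₗ[K] K)) := by
      intro c t
      rw [Submodule.span_le, Set.image_subset_iff]
      refine forall₂_congr fun w _ => ?_
      simp only [Set.mem_preimage, SetLike.mem_coe, LinearMap.mem_ker, LinearMap.sum_apply,
        LinearMap.smul_apply, LinearMap.proj_apply, smul_eq_mul, r, ← map_mul, ← map_sum]
      exact (map_eq_zero_iff _ hinj).symm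
    by_contra htop
    obtain ⟨φ, hφ0, hφ⟩ := Submodule.exists_le_ker_of_lt_top _ (lt_top_iff_ne_top.mpr htop)
    obtain ⟨⟨b, hb⟩, hbint⟩ := IsLocalization.exist_integer_multiples_of_finset
      (nonZeroDivisors (MvPolynomial σ k)) (Finset.univ.image fun i => φ (Pi.single i 1))
    have hbint' : ∀ i, ∃ c, algebraMap (MvPolynomial σ k) K c = b • φ (Pi.single i 1) := fun i =>
      hbint _ (Finset.mem_image_of_mem _ (Finset.mem_univ i))
    choose c hc using hbint'
    have hb0 : algebraMap _ K b ≠ 0 := by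
      rw [Ne, map_eq_zero_iff _ hinj]
      exact nonZeroDivisors.ne_zero hb
    have hφc : (∑ i, algebraMap _ K (c i) • (LinearMap.proj i : (Fin d → K) →ₗ[K] K)) =
        algebraMap _ K b • φ := by
      refine LinearMap.pi_ext' fun i => LinearMap.ext_ring ?_
      simp [Pi.single_apply, hc, Algebra.smul_def]
    have hcs : ∀ w : List σ, w.length ≤ s → ∑ i, c i * iterPDeriv w (g i) = 0 := by
      rw [hker, hφc, LinearMap.ker_smul _ _ hb0]
      exact hφ
    have hc0 := eq_zero_of_forall_sum_mul_iterPDeriv hg c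
      (forall_sum_mul_iterPDeriv_eq_zero_of_step
        (fun c h => (hker c (s + 1)).mpr (hs ▸ (hker c s).mp h)) c hcs)
    apply hφ0
    have : algebraMap _ K b • φ = 0 := by
      rw [← hφc, hc0]
      simp
    exact (smul_eq_zero.mp this).resolve_left hb0
  have hr₀ : r [] ≠ 0 := by
    intro h
    have i₀ : Fin d := ⟨0, by omega⟩
    exact hg.ne_zero i₀ ((map_eq_zero_iff _ hinj).mp (congrFun h i₀))
  obtain ⟨M, w, hind, hle, hsum, hMd, htop⟩ := exists_linearIndependent_sum_order_ge
    (K := K) (V := Fin d → K) (d := d) (by simp) r List.length [] rfl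
    hr₀ hstep
  refine ⟨M, w, ?_, hle, hsum, ?_, hMd⟩
  · intro h0
    have hunit : IsUnit (Matrix.of (r ∘ w)) :=
      Matrix.linearIndependent_rows_iff_isUnit.mp hind
    rw [Matrix.isUnit_iff_isUnit_det, isUnit_iff_ne_zero] at hunit
    apply hunit
    have : Matrix.of (r ∘ w) = (algebraMap _ K).mapMatrix (jetMatrix w g) := rfl
    rw [this, ← RingHom.map_det, h0, map_zero]
  · by_contra hM
    obtain rfl : M = 0 := by omega
    have hone : r '' {w : List σ | w.length ≤ 0} = {r []} := by
      have : {w : List σ | w.length ≤ 0} = {[]} := by ext w; simp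
      rw [this, Set.image_singleton]
    rw [hone] at htop
    have h1 := finrank_span_le_card (R := K) ({r []} : Set (Fin d → K))
    rw [htop, finrank_top] at h1
    simp at h1
    omega

end GeneralizedWronskian

section Ears

variable {ι k V : Type*} [Fintype ι] [DecidableEq ι] [Field k] [AddCommGroup V] [Module k V]

/-- If the spans of the vectors indexed by `E` and by its complement meet, then `E` can be enlarged
by a set `D` for which the rank grows by one less than the cardinality of `D`, where any element of
`D` is spanned by `E` and the other elements of `D`. -/
theorem exists_ear {f : ι → V} {E : Finset ι}
    (h : Submodule.span k (f '' E) ⊓ Submodule.span k (f '' (Eᶜ : Finset ι)) ≠ ⊥) :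
    ∃ D : Finset ι, Disjoint E D ∧ D.Nonempty ∧
      (∃ g, g ≠ 0 ∧ g ∈ Submodule.span k (f '' E) ∧ g ∈ Submodule.span k (f '' D)) ∧
      (∀ e ∈ D, f e ∈ Submodule.span k (f '' (E ∪ D.erase e : Finset ι))) ∧
      Module.finrank k (Submodule.span k (f '' (E ∪ D : Finset ι))) + 1 =
        Module.finrank k (Submodule.span k (f '' E)) + D.card := by
  let 𝒟 : Set (Finset ι) :=
    {D | D ⊆ Eᶜ ∧ Submodule.span k (f '' E) ⊓ Submodule.span k (f '' D) ≠ ⊥}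
  obtain ⟨D, hD⟩ := (Set.toFinite 𝒟).exists_minimal ⟨Eᶜ, subset_rfl, h⟩
  obtain ⟨⟨hDE, hDne⟩, hmin⟩ := hD
  have herase : ∀ e ∈ D,
      Submodule.span k (f '' E) ⊓ Submodule.span k (f '' (D.erase e : Finset ι)) = ⊥ := by
    intro e he
    by_contra hc
    exact Finset.notMem_erase e D
      (hmin ⟨(Finset.erase_subset e D).trans hDE, hc⟩ (Finset.erase_subset e D) he)
  have hspan : ∀ e ∈ D, Submodule.span k (f '' D) =
      Submodule.span k (insert (f e) (f '' (D.erase e : Finset ι))) := by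
    intro e he
    rw [← Set.image_insert_eq, ← Finset.coe_insert, Finset.insert_erase he]
  obtain ⟨g, hg, hg0⟩ := Submodule.exists_mem_ne_zero_of_ne_bot hDne
  obtain ⟨hgE, hgD⟩ := Submodule.mem_inf.mp hg
  have hDnonempty : D.Nonempty := by
    rw [Finset.nonempty_iff_ne_empty]
    rintro rfl
    simp at hgD
    exact hg0 hgD
  have hind : LinearIndepOn k f (D : Set ι) := by
    rw [linearIndepOn_iff_notMem_span]
    intro e he hmem
    rw [← Finset.coe_erase] at hmem
    apply hDne
    rw [hspan e he, Submodule.span_insert_eq_span hmem, herase e he]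
  have hmem : ∀ e ∈ D, f e ∈ Submodule.span k (f '' (E ∪ D.erase e : Finset ι)) := by
    intro e he
    have hgD' := hgD
    rw [hspan e he, Submodule.mem_span_insert] at hgD'
    obtain ⟨a, y, hy, hgy⟩ := hgD'
    rw [Finset.coe_union, Set.image_union, Submodule.span_union]
    have ha : a ≠ 0 := by
      rintro rfl
      rw [zero_smul, zero_add] at hgy
      apply hg0
      rw [← Submodule.mem_bot k, ← herase e he]
      exact ⟨hgE, hgy ▸ hy⟩
    have : f e = a⁻¹ • (g - y) := by
      rw [hgy, add_sub_cancel_right, inv_smul_smul₀ ha]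
    rw [this]
    exact Submodule.smul_mem _ _ (Submodule.sub_mem _ (Submodule.mem_sup_left hgE)
      (Submodule.mem_sup_right hy))
  refine ⟨D, ?_, hDnonempty, ⟨g, hg0, hgE, hgD⟩, hmem, ?_⟩
  · exact (Finset.subset_compl_iff_disjoint_left.mp hDE)
  · obtain ⟨e, he⟩ := hDnonempty
    have hsup : Submodule.span k (f '' (E ∪ D : Finset ι)) =
        Submodule.span k (f '' E) ⊔ Submodule.span k (f '' (D.erase e : Finset ι)) := by
      rw [← Submodule.span_union, ← Set.image_union, ← Finset.coe_union,
        ← Submodule.span_insert_eq_span (hmem e he), ← Set.image_insert_eq, ← Finset.coe_insert,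
        ← Finset.union_insert, Finset.insert_erase he]
    have hrank : Module.finrank k (Submodule.span k (f '' (D.erase e : Finset ι))) =
        (D.erase e).card := by
      have hi : LinearIndepOn k f (D.erase e : Finset ι) :=
        hind.mono (Finset.coe_subset.mpr (Finset.erase_subset e D))
      have h1 := finrank_span_eq_card (show LinearIndependent k fun i : D.erase e => f i from hi)
      rw [Fintype.card_coe] at h1
      rw [← h1, Set.image_eq_range]
      rfl
    have := FiniteDimensional.span_of_finite k (Set.toFinite (f '' E))
    have := FiniteDimensional.span_of_finite k (Set.toFinite (f '' (D.erase e : Finset ι)))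
    have h1 := Submodule.finrank_sup_add_finrank_inf_eq (Submodule.span k (f '' E))
      (Submodule.span k (f '' (D.erase e : Finset ι)))
    rw [herase e he, finrank_bot, hrank, Finset.card_erase_of_mem he, ← hsup] at h1
    have := Finset.card_pos.mpr ⟨e, he⟩
    omega

theorem sum_eq_zero_of_span_inf_span_compl_eq_bot {f : ι → V} (hsum : ∑ i, f i = 0)
    {E : Finset ι}
    (h : Submodule.span k (f '' E) ⊓ Submodule.span k (f '' (Eᶜ : Finset ι)) = ⊥) :
    ∑ i ∈ E, f i = 0 := by
  have hmem : ∀ S : Finset ι, ∑ i ∈ S, f i ∈ Submodule.span k (f '' S) := fun S =>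
    Submodule.sum_mem _ fun i hi => Submodule.subset_span ⟨i, hi, rfl⟩
  rw [← Submodule.mem_bot k, ← h]
  refine ⟨hmem E, ?_⟩
  rw [← Finset.sum_add_sum_compl E] at hsum
  rw [eq_neg_of_add_eq_zero_left hsum]
  exact Submodule.neg_mem _ (hmem Eᶜ)

end Ears

section DegreesOfSpans

variable {σ k ι : Type*} [Field k]

theorem totalDegree_le_sup_of_mem_span {f : ι → MvPolynomial σ k} {A : Finset ι}
    {g : MvPolynomial σ k} (hg : g ∈ Submodule.span k (f '' A)) :
    g.totalDegree ≤ A.sup fun i => (f i).totalDegree := by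
  rw [← mem_restrictTotalDegree]
  refine (Submodule.span_le.mpr ?_) hg
  rintro _ ⟨i, hi, rfl⟩
  rw [SetLike.mem_coe, mem_restrictTotalDegree]
  exact Finset.le_sup (f := fun i => (f i).totalDegree) hi

theorem totalDegree_eq_of_associated {p q : MvPolynomial σ k} (h : Associated p q) :
    p.totalDegree = q.totalDegree := by
  by_cases hp : p = 0
  · rw [hp, (associated_zero_iff_eq_zero q).mp (hp ▸ h).symm]
  · exact le_antisymm (totalDegree_le_of_dvd_of_isDomain h.dvd (h.ne_zero_iff.mp hp))
      (totalDegree_le_of_dvd_of_isDomain h.dvd' hp)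

variable [NormalizedGCDMonoid (MvPolynomial σ k)]

theorem gcd_dvd_of_mem_span {f : ι → MvPolynomial σ k} {A : Finset ι}
    {g : MvPolynomial σ k} (hg : g ∈ Submodule.span k (f '' A)) : A.gcd f ∣ g := by
  induction hg using Submodule.span_induction with
  | mem x hx =>
    obtain ⟨i, hi, rfl⟩ := hx
    exact Finset.gcd_dvd hi
  | zero => exact dvd_zero _
  | add x y _ _ hx hy => exact dvd_add hx hy
  | smul a x _ hx =>
    rw [smul_eq_C_mul]
    exact hx.mul_left _

theorem finset_gcd_ne_zero {f : ι → MvPolynomial σ k} (hne : ∀ i, f i ≠ 0) {A : Finset ι}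
    (hA : A.Nonempty) : A.gcd f ≠ 0 := by
  obtain ⟨i, hi⟩ := hA
  intro h
  exact hne i (Finset.gcd_eq_zero_iff.mp h i hi)

theorem totalDegree_finset_gcd_le_sup {f : ι → MvPolynomial σ k} (hne : ∀ i, f i ≠ 0)
    {A : Finset ι} (hA : A.Nonempty) :
    (A.gcd f).totalDegree ≤ A.sup fun i => (f i).totalDegree := by
  obtain ⟨i, hi⟩ := hA
  exact (totalDegree_le_of_dvd_of_isDomain (Finset.gcd_dvd hi) (hne i)).trans
    (Finset.le_sup (f := fun i => (f i).totalDegree) hi)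

theorem totalDegree_gcd_add_totalDegree_gcd_le [DecidableEq ι] {f : ι → MvPolynomial σ k}
    {A D : Finset ι} {g : MvPolynomial σ k} (hg0 : g ≠ 0)
    (hA : g ∈ Submodule.span k (f '' A)) (hD : g ∈ Submodule.span k (f '' D)) :
    (A.gcd f).totalDegree + (D.gcd f).totalDegree ≤
      g.totalDegree + ((A ∪ D).gcd f).totalDegree := by
  have hAg := gcd_dvd_of_mem_span hA
  have hDg := gcd_dvd_of_mem_span hD
  have hlcm := lcm_dvd hAg hDg
  have hA0 := ne_zero_of_dvd_ne_zero hg0 hAg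
  have hD0 := ne_zero_of_dvd_ne_zero hg0 hDg
  have h := totalDegree_eq_of_associated (gcd_mul_lcm (A.gcd f) (D.gcd f))
  rw [totalDegree_mul_of_isDomain (fun h => hA0 ((gcd_eq_zero_iff _ _).mp h).1)
    (ne_zero_of_dvd_ne_zero hg0 hlcm), totalDegree_mul_of_isDomain hA0 hD0] at h
  have h2 := totalDegree_le_of_dvd_of_isDomain hlcm hg0
  rw [Finset.gcd_union]
  omega

end DegreesOfSpans

section SpansOfUnions

variable {ι k V : Type*} [DecidableEq ι] [Field k] [AddCommGroup V] [Module k V]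

theorem span_image_union_eq_of_subset_span {f : ι → V}
    {A B : Finset ι} (hAB : A ⊆ B) (hBA : ∀ i ∈ B, f i ∈ Submodule.span k (f '' A))
    (T : Finset ι) : Submodule.span k (f '' (A ∪ T : Finset ι)) =
      Submodule.span k (f '' (B ∪ T : Finset ι)) := by
  have : Submodule.span k (f '' A) = Submodule.span k (f '' B) := by
    refine le_antisymm (Submodule.span_mono (Set.image_mono (Finset.coe_subset.mpr hAB))) ?_
    rw [Submodule.span_le]
    rintro _ ⟨i, hi, rfl⟩
    exact hBA i hi
  simp only [Finset.coe_union, Set.image_union, Submodule.span_union, this]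

theorem mem_span_of_mem_union_erase {f : ι → V}
    {E D : Finset ι} {e : ι}
    (he : f e ∈ Submodule.span k (f '' (E ∪ D.erase e : Finset ι))) :
    ∀ i ∈ E ∪ D, f i ∈ Submodule.span k (f '' (E ∪ D.erase e : Finset ι)) := by
  intro i hi
  by_cases hie : i = e
  · exact hie ▸ he
  · refine Submodule.subset_span ⟨i, ?_, rfl⟩
    simp only [Finset.coe_union, Set.mem_union, Finset.mem_coe, Finset.mem_erase]
    rcases Finset.mem_union.mp hi with h | h
    · exact Or.inl h
    · exact Or.inr ⟨hie, h⟩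

end SpansOfUnions

section PartialBounds

variable {σ k ι : Type*} [Field k] [DecidableEq ι]

/-- Divisibility and degree bounds for a Wronskian-like pair `U`, `N` that hold for every way of
completing a basis of the span of the `f i` with `i ∈ E` to a basis of the span of all `f i`. -/
def IsPartialBound (f : ι → MvPolynomial σ k) (o : ι) (U : MvPolynomial σ k) (N : ℕ)
    (E : Finset ι) (H : MvPolynomial σ k) (h : ℕ) : Prop :=
  ∀ T : Finset ι, Disjoint E T →
    Submodule.span k (f '' (E ∪ T : Finset ι)) = Submodule.span k (Set.range f) →
    T.card + Module.finrank k (Submodule.span k (f '' E)) =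
      Module.finrank k (Submodule.span k (Set.range f)) →
    ((∏ i ∈ E.erase o, f i) * ∏ i ∈ T, f i ∣ U * H) ∧
      N + h ≤ ∑ i ∈ E, (f i).totalDegree + ∑ i ∈ T, (f i).totalDegree

variable {f : ι → MvPolynomial σ k} {o : ι} {U : MvPolynomial σ k} {N : ℕ}
  {E : Finset ι} {H : MvPolynomial σ k} {h : ℕ}

theorem IsPartialBound.union_ear [NormalizedGCDMonoid (MvPolynomial σ k)]
    (hE : IsPartialBound f o U N E H h) (ho : o ∈ E) {D : Finset ι} (hED : Disjoint E D)
    (hD : D.Nonempty)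
    (hmem : ∀ e ∈ D, f e ∈ Submodule.span k (f '' (E ∪ D.erase e : Finset ι)))
    (hrank : Module.finrank k (Submodule.span k (f '' (E ∪ D : Finset ι))) + 1 =
        Module.finrank k (Submodule.span k (f '' E)) + D.card) :
    IsPartialBound f o U N (E ∪ D) (H * D.gcd f) (h + D.sup fun i => (f i).totalDegree) := by
  intro T hT hspan hcard
  rw [Finset.disjoint_union_left] at hT
  have key : ∀ e ∈ D, ((∏ i ∈ E.erase o, f i) * ((∏ i ∈ D.erase e, f i) * ∏ i ∈ T, f i) ∣ U * H) ∧
      N + h ≤ ∑ i ∈ E, (f i).totalDegree +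
        (∑ i ∈ D.erase e, (f i).totalDegree + ∑ i ∈ T, (f i).totalDegree) := by
    intro e he
    have hdisj : Disjoint (D.erase e) T := hT.2.mono_left (Finset.erase_subset e D)
    rw [← Finset.prod_union hdisj, ← Finset.sum_union hdisj]
    refine hE _ ?_ ?_ ?_
    · rw [Finset.disjoint_union_right]
      exact ⟨hED.mono_right (Finset.erase_subset e D), hT.1⟩
    · rw [← Finset.union_assoc, span_image_union_eq_of_subset_span
        (Finset.union_subset_union_right (Finset.erase_subset e D))
        (mem_span_of_mem_union_erase (hmem e he)), hspan]
    · rw [Finset.card_union_of_disjoint hdisj, Finset.card_erase_of_mem he]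
      have := Finset.card_pos.mpr hD
      omega
  constructor
  · have hoD : o ∉ D := Finset.disjoint_left.mp hED ho
    have hunion : (E ∪ D).erase o = E.erase o ∪ D := by
      rw [Finset.erase_union_distrib, Finset.erase_eq_of_notMem hoD]
    rw [hunion, Finset.prod_union (hED.mono_left (Finset.erase_subset o E)), ← mul_assoc]
    refine (Finset.dvd_gcd fun e he => ?_ : _ ∣ D.gcd fun e => (U * H) * f e).trans
      (Finset.gcd_mul_left' (s := D) (f := f) (U * H)).dvd
    obtain ⟨q, hq⟩ := (key e he).1
    refine ⟨q, ?_⟩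
    rw [hq, ← Finset.mul_prod_erase D f he]
    ring
  · obtain ⟨e, he, hsup⟩ := Finset.exists_mem_eq_sup D hD fun i => (f i).totalDegree
    have h1 := (key e he).2
    have h2 := Finset.add_sum_erase D (fun i => (f i).totalDegree) he
    rw [Finset.sum_union hED, hsup]
    omega

theorem IsPartialBound.insert_of_notMem_span (hE : IsPartialBound f o U N E H h) (ho : o ∈ E)
    {a : ι} (ha : f a ∉ Submodule.span k (f '' E)) :
    IsPartialBound f o U N (E ∪ {a}) H h := by
  have haE : a ∉ E := fun h => ha (Submodule.subset_span ⟨a, h, rfl⟩)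
  intro T hT hspan hcard
  rw [Finset.disjoint_union_left, Finset.disjoint_singleton_left] at hT
  have hrank : Module.finrank k (Submodule.span k (f '' (E ∪ {a} : Finset ι))) =
      Module.finrank k (Submodule.span k (f '' E)) + 1 := by
    have hfin := FiniteDimensional.span_of_finite k (Set.toFinite (f '' E))
    have h1 := Submodule.finrank_sup_add_finrank_inf_eq (Submodule.span k (f '' E))
      (Submodule.span k {f a})
    have hinf : Submodule.span k (f '' E) ⊓ Submodule.span k {f a} = ⊥ := by
      rw [← disjoint_iff, Submodule.disjoint_span_singleton]
      exact fun h => absurd h ha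
    rw [hinf, finrank_bot, finrank_span_singleton (fun h => ha (by rw [h]; exact zero_mem _)),
      ← Submodule.span_union] at h1
    rw [← h1, add_zero, Finset.coe_union, Set.image_union, Finset.coe_singleton,
      Set.image_singleton]
  have hE' := hE (insert a T) (by
      rw [Finset.disjoint_insert_right]
      exact ⟨haE, hT.1⟩)
    (by rw [← hspan, Finset.union_assoc, Finset.singleton_union])
    (by rw [Finset.card_insert_of_notMem hT.2]; omega)
  have hoa : o ≠ a := fun h => haE (h ▸ ho)
  rw [Finset.prod_insert hT.2, Finset.sum_insert hT.2] at hE'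
  have hu : (E ∪ {a}).erase o = E.erase o ∪ {a} := by
    rw [Finset.erase_union_distrib, Finset.erase_eq_of_notMem (s := {a}) (by simpa using hoa)]
  have hd : Disjoint E {a} := Finset.disjoint_singleton_right.mpr haE
  rw [hu, Finset.prod_union (hd.mono_left (Finset.erase_subset o E)), Finset.sum_union hd,
    Finset.prod_singleton, Finset.sum_singleton, mul_assoc, add_assoc]
  exact hE'

variable [Fintype ι]

/-- The divisibility and degree bounds for bases lead to a partial bound. -/
theorem exists_isPartialBound (hne : ∀ i, f i ≠ 0) (hsum : ∑ i, f i = 0)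
    (hU : ∀ B : Finset ι, Submodule.span k (f '' B) = Submodule.span k (Set.range f) →
      B.card = Module.finrank k (Submodule.span k (Set.range f)) →
      (o ∉ B → ∏ i ∈ B, f i ∣ U) ∧ N ≤ ∑ i ∈ B, (f i).totalDegree) :
    ∃ E, o ∈ E ∧ IsPartialBound f o U N E 1 (E.sup fun i => (f i).totalDegree) := by
  have hne_bot : Submodule.span k (f '' ({o} : Finset ι)) ⊓
      Submodule.span k (f '' (({o} : Finset ι)ᶜ : Finset ι)) ≠ ⊥ := by
    intro h
    have := sum_eq_zero_of_span_inf_span_compl_eq_bot hsum h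
    rw [Finset.sum_singleton] at this
    exact hne o this
  obtain ⟨D, hoD, hD, ⟨g, hg0, hgo, hgD⟩, hmem, hrank⟩ := exists_ear hne_bot
  rw [Finset.disjoint_singleton_left] at hoD
  have hoD' : f o ∈ Submodule.span k (f '' D) := by
    rw [Finset.coe_singleton, Set.image_singleton] at hgo
    obtain ⟨c, rfl⟩ := Submodule.mem_span_singleton.mp hgo
    exact (Submodule.smul_mem_iff _ (fun h => hg0 (by rw [h, zero_smul]))).mp hgD
  have hrank_o : Module.finrank k (Submodule.span k (f '' ({o} : Finset ι))) = 1 := by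
    rw [Finset.coe_singleton, Set.image_singleton, finrank_span_singleton (hne o)]
  refine ⟨{o} ∪ D, by simp, fun T hT hspan hcard => ?_⟩
  rw [Finset.disjoint_union_left, Finset.disjoint_singleton_left] at hT
  have hDT := hU (D ∪ T) (by
      rw [← hspan]
      refine span_image_union_eq_of_subset_span Finset.subset_union_right (fun i hi => ?_) T
      rcases Finset.mem_union.mp hi with hi | hi
      · rw [Finset.mem_singleton.mp hi]
        exact hoD'
      · exact Submodule.subset_span ⟨i, hi, rfl⟩)
    (by rw [Finset.card_union_of_disjoint hT.2]; omega)
  have hdo : Disjoint {o} D := Finset.disjoint_singleton_left.mpr hoD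
  constructor
  · rw [Finset.erase_union_distrib, Finset.erase_singleton, Finset.empty_union,
      Finset.erase_eq_of_notMem hoD, ← Finset.prod_union hT.2, mul_one]
    exact hDT.1 (by simp [hoD, hT.1])
  · obtain ⟨e, he, hsup⟩ := Finset.exists_mem_eq_sup ({o} ∪ D) ⟨o, by simp⟩
      fun i => (f i).totalDegree
    rw [hsup]
    rcases Finset.mem_union.mp he with he | he
    · rw [Finset.mem_singleton.mp he, Finset.sum_union hdo, Finset.sum_singleton]
      have := hDT.2
      rw [Finset.sum_union hT.2] at this
      omega
    · have hde : Disjoint {o} (D.erase e) := hdo.mono_right (Finset.erase_subset e D)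
      have hdT : Disjoint ({o} ∪ D.erase e) T := by
        rw [Finset.disjoint_union_left, Finset.disjoint_singleton_left]
        exact ⟨hT.1, hT.2.mono_left (Finset.erase_subset e D)⟩
      have h1 := (hU ({o} ∪ D.erase e ∪ T) (by
          rw [span_image_union_eq_of_subset_span
            (Finset.union_subset_union_right (Finset.erase_subset e D))
            (mem_span_of_mem_union_erase (hmem e he)), hspan])
        (by
          rw [Finset.card_union_of_disjoint hdT, Finset.card_union_of_disjoint hde,
            Finset.card_erase_of_mem he, Finset.card_singleton]
          have := Finset.card_pos.mpr hD
          omega)).2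
      have h2 := Finset.add_sum_erase D (fun i => (f i).totalDegree) he
      rw [Finset.sum_union hdT, Finset.sum_union hde, Finset.sum_singleton] at h1
      rw [Finset.sum_union hdo, Finset.sum_singleton]
      omega

variable [NormalizedGCDMonoid (MvPolynomial σ k)]

/-- A partial bound for `E` extends to the component of the complement of `E` that contains `a`. -/
theorem IsPartialBound.exists_component (hE : IsPartialBound f o U N E H h) (ho : o ∈ E)
    (hne : ∀ i, f i ≠ 0) (hH : H ≠ 0)
    (hEc : Submodule.span k (f '' E) ⊓ Submodule.span k (f '' (Eᶜ : Finset ι)) = ⊥)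
    {a : ι} (ha : a ∉ E) :
    ∃ (A : Finset ι) (H' : MvPolynomial σ k) (h' : ℕ), A.Nonempty ∧ Disjoint E A ∧ H' ≠ 0 ∧
      IsPartialBound f o U N (E ∪ A) H' h' ∧
      H'.totalDegree + h + (A.sup fun i => (f i).totalDegree) ≤
        h' + H.totalDegree + (A.gcd f).totalDegree ∧
      Submodule.span k (f '' (E ∪ A : Finset ι)) ⊓
        Submodule.span k (f '' ((E ∪ A)ᶜ : Finset ι)) = ⊥ := by
  let 𝒜 : Set (Finset ι) := {A | A.Nonempty ∧ Disjoint E A ∧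
    ∃ (H' : MvPolynomial σ k) (h' : ℕ), H' ≠ 0 ∧ IsPartialBound f o U N (E ∪ A) H' h' ∧
      H'.totalDegree + h + (A.sup fun i => (f i).totalDegree) ≤
        h' + H.totalDegree + (A.gcd f).totalDegree}
  have h𝒜 : 𝒜.Nonempty := by
    refine ⟨{a}, Finset.singleton_nonempty a, Finset.disjoint_singleton_right.mpr ha, H, h, hH,
      hE.insert_of_notMem_span ho fun hmem => hne a ?_, ?_⟩
    · rw [← Submodule.mem_bot k, ← hEc]
      exact ⟨hmem, Submodule.subset_span ⟨a, by simpa using ha, rfl⟩⟩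
    · rw [Finset.sup_singleton, Finset.gcd_singleton,
        totalDegree_eq_of_associated (normalize_associated (f a))]
      omega
  obtain ⟨A, ⟨hA, hEA, H', h', hH', hb, hle⟩, hmax⟩ := (Set.toFinite 𝒜).exists_maximal h𝒜
  refine ⟨A, H', h', hA, hEA, hH', hb, hle, ?_⟩
  by_contra hc
  obtain ⟨D, hdisj, hD, ⟨g, hg0, hgE, hgD⟩, hmem, hrank⟩ := exists_ear hc
  rw [Finset.disjoint_union_left] at hdisj
  have hgA : g ∈ Submodule.span k (f '' A) := by
    rw [Finset.coe_union, Set.image_union, Submodule.span_union] at hgE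
    obtain ⟨x, hx, y, hy, rfl⟩ := Submodule.mem_sup.mp hgE
    have hsub : ∀ S : Finset ι, Disjoint E S →
        Submodule.span k (f '' S) ≤ Submodule.span k (f '' (Eᶜ : Finset ι)) := fun S hS =>
      Submodule.span_mono (Set.image_mono (Finset.coe_subset.mpr
        (Finset.subset_compl_iff_disjoint_left.mpr hS)))
    have hx0 : x ∈ (⊥ : Submodule k (MvPolynomial σ k)) := by
      rw [← hEc]
      refine ⟨hx, ?_⟩
      rw [← add_sub_cancel_right x y]
      exact Submodule.sub_mem _ (hsub D hdisj.1 hgD) (hsub A hEA hy)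
    rw [(Submodule.mem_bot k).mp hx0, zero_add]
    exact hy
  have hgcd := totalDegree_gcd_add_totalDegree_gcd_le hg0 hgA hgD
  have hsupA := totalDegree_le_sup_of_mem_span hgA
  have hsupD := totalDegree_le_sup_of_mem_span hgD
  have hmem𝒜 : A ∪ D ∈ 𝒜 := by
    refine ⟨hA.mono Finset.subset_union_left, Finset.disjoint_union_right.mpr ⟨hEA, hdisj.1⟩, _,
      h' + D.sup fun i => (f i).totalDegree,
      mul_ne_zero hH' (finset_gcd_ne_zero hne hD), ?_, ?_⟩
    · rw [← Finset.union_assoc]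
      exact hb.union_ear (Finset.mem_union_left A ho) (Finset.disjoint_union_left.mpr hdisj) hD
        hmem hrank
    · rw [totalDegree_mul_of_isDomain hH' (finset_gcd_ne_zero hne hD), Finset.sup_union]
      rcases le_total (A.sup fun i => (f i).totalDegree) (D.sup fun i => (f i).totalDegree)
        with hs | hs
      · rw [sup_eq_right.mpr hs]
        omega
      · rw [sup_eq_left.mpr hs]
        omega
  obtain ⟨e, he⟩ := hD
  exact Finset.disjoint_left.mp hdisj.2
    (hmax hmem𝒜 Finset.subset_union_left (Finset.mem_union_right A he)) he

theorem exists_isPartialBound_univ (hne : ∀ i, f i ≠ 0) (hsum : ∑ i, f i = 0)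
    (hgcd : ∀ S : Finset ι, S.Nonempty → ∑ i ∈ S, f i = 0 →
      (S.gcd f).totalDegree ≤ (f o).totalDegree)
    (hU : ∀ B : Finset ι, Submodule.span k (f '' B) = Submodule.span k (Set.range f) →
      B.card = Module.finrank k (Submodule.span k (Set.range f)) →
      (o ∉ B → ∏ i ∈ B, f i ∣ U) ∧ N ≤ ∑ i ∈ B, (f i).totalDegree) :
    ∃ (H : MvPolynomial σ k) (h : ℕ), H ≠ 0 ∧ IsPartialBound f o U N Finset.univ H h ∧
      H.totalDegree + (Finset.univ.sup fun i => (f i).totalDegree) ≤ h := by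
  let 𝓔 : Set (Finset ι) := {E | o ∈ E ∧ ∃ (H : MvPolynomial σ k) (h : ℕ), H ≠ 0 ∧
    IsPartialBound f o U N E H h ∧ H.totalDegree + (E.sup fun i => (f i).totalDegree) ≤ h}
  have h𝓔 : 𝓔.Nonempty := by
    obtain ⟨E, ho, hE⟩ := exists_isPartialBound hne hsum hU
    exact ⟨E, ho, 1, _, one_ne_zero, hE, by simp⟩
  obtain ⟨E, ⟨ho, H, h, hH, hE, hle⟩, hmax⟩ := (Set.toFinite 𝓔).exists_maximal h𝓔
  have hEc : Submodule.span k (f '' E) ⊓ Submodule.span k (f '' (Eᶜ : Finset ι)) = ⊥ := by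
    by_contra hc
    obtain ⟨D, hdisj, hD, ⟨g, hg0, hgE, hgD⟩, hmem, hrank⟩ := exists_ear hc
    have hsupE := totalDegree_le_sup_of_mem_span hgE
    have hgcdD := totalDegree_le_of_dvd_of_isDomain (gcd_dvd_of_mem_span hgD) hg0
    have hsupD := totalDegree_finset_gcd_le_sup hne hD
    have hmem𝓔 : E ∪ D ∈ 𝓔 := by
      refine ⟨Finset.mem_union_left D ho, _, _, mul_ne_zero hH (finset_gcd_ne_zero hne hD),
        hE.union_ear ho hdisj hD hmem hrank, ?_⟩
      rw [totalDegree_mul_of_isDomain hH (finset_gcd_ne_zero hne hD), Finset.sup_union]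
      rcases le_total (E.sup fun i => (f i).totalDegree) (D.sup fun i => (f i).totalDegree)
        with hs | hs
      · rw [sup_eq_right.mpr hs]
        omega
      · rw [sup_eq_left.mpr hs]
        omega
    obtain ⟨e, he⟩ := hD
    exact Finset.disjoint_left.mp hdisj
      (hmax hmem𝓔 Finset.subset_union_left (Finset.mem_union_right E he)) he
  suffices hEuniv : E = Finset.univ from ⟨H, h, hH, hEuniv ▸ hE, hEuniv ▸ hle⟩
  by_contra hEuniv
  obtain ⟨a, ha⟩ : ∃ a, a ∉ E := by
    by_contra! hall
    exact hEuniv (Finset.eq_univ_iff_forall.mpr hall)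
  obtain ⟨A, H', h', hA, hEA, hH', hb, hle', hEAc⟩ := hE.exists_component ho hne hH hEc ha
  have hsumE := sum_eq_zero_of_span_inf_span_compl_eq_bot hsum hEc
  have hsumEA := sum_eq_zero_of_span_inf_span_compl_eq_bot hsum hEAc
  rw [Finset.sum_union hEA, hsumE, zero_add] at hsumEA
  have h1 := hgcd A hA hsumEA
  have h2 := totalDegree_finset_gcd_le_sup hne hA
  have h3 : (f o).totalDegree ≤ E.sup fun i => (f i).totalDegree :=
    Finset.le_sup (f := fun i => (f i).totalDegree) ho
  have hmem𝓔 : E ∪ A ∈ 𝓔 := by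
    refine ⟨Finset.mem_union_left A ho, H', h', hH', hb, ?_⟩
    rw [Finset.sup_union]
    rcases le_total (E.sup fun i => (f i).totalDegree) (A.sup fun i => (f i).totalDegree)
      with hs | hs
    · rw [sup_eq_right.mpr hs]
      omega
    · rw [sup_eq_left.mpr hs]
      omega
  obtain ⟨e, he⟩ := hA
  exact Finset.disjoint_left.mp hEA
    (hmax hmem𝓔 Finset.subset_union_left (Finset.mem_union_right E he)) he

end PartialBounds

section DegreeBound

variable {σ k ι : Type*} [Field k] [CharZero k] [Fintype ι] [DecidableEq ι]
  [NormalizedGCDMonoid (MvPolynomial σ k)]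

theorem exists_totalDegree_bound {f : ι → MvPolynomial σ k} (o : ι) (hne : ∀ i, f i ≠ 0)
    (hsum : ∑ i, f i = 0)
    (hgcd : ∀ S : Finset ι, S.Nonempty → ∑ i ∈ S, f i = 0 →
      (S.gcd f).totalDegree ≤ (f o).totalDegree)
    (hdim : 2 ≤ Module.finrank k (Submodule.span k (Set.range f))) :
    ∃ M, 1 ≤ M ∧ M + 1 ≤ Module.finrank k (Submodule.span k (Set.range f)) ∧
      2 * (Finset.univ.sup fun i => (f i).totalDegree) + M * (M + 1) ≤ 2 * (f o).totalDegree +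
        2 * (M * ∑ i ∈ Finset.univ.erase o,
          (UniqueFactorizationMonoid.radical (f i)).totalDegree) := by
  have hfin := FiniteDimensional.span_of_finite k (Set.finite_range f)
  set d := Module.finrank k (Submodule.span k (Set.range f)) with hd
  let b := Module.finBasisOfFinrankEq k (Submodule.span k (Set.range f)) hd.symm
  have hg : LinearIndependent k fun i => (b i : MvPolynomial σ k) :=
    b.linearIndependent.map' (Submodule.subtype _) (Submodule.ker_subtype _)
  obtain ⟨M, w, hW, hlen, hs, hM, hMd⟩ := exists_det_jetMatrix_ne_zero hdim hg
  set W := (jetMatrix w fun i => (b i : MvPolynomial σ k)).det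
  have hr : ∏ i ∈ Finset.univ.erase o, UniqueFactorizationMonoid.radical (f i) ^ M ≠ 0 :=
    Finset.prod_ne_zero_iff.mpr fun i _ =>
      pow_ne_zero _ UniqueFactorizationMonoid.radical_ne_zero
  obtain ⟨H, h, hH, hbd, hle⟩ := exists_isPartialBound_univ (o := o)
    (U := W * ∏ i ∈ Finset.univ.erase o, UniqueFactorizationMonoid.radical (f i) ^ M)
    (N := W.totalDegree + ∑ j, (w j).length) hne hsum hgcd (by
      intro B hB hcard
      let e := (B.equivFinOfCardEq hcard).symm
      have hrange : Set.range (fun j => f (e j)) = f '' B := by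
        rw [Set.image_eq_range]
        exact e.surjective.range_comp fun i : B => f i
      obtain ⟨c, hc⟩ := det_jetMatrix_eq_C_mul (k := k) w
        (g := fun i => (b i : MvPolynomial σ k)) (b := fun j => f (e j)) (fun i => by
          rw [hrange, hB]
          exact (b i).2)
      change W = _ at hc
      have hprod : ∀ φ : ι → MvPolynomial σ k, ∏ j, φ (e j) = ∏ i ∈ B, φ i := fun φ => by
        rw [Equiv.prod_comp e fun i : B => φ i, Finset.prod_coe_sort B φ]
      constructor
      · intro hoB
        have h1 := prod_dvd_det_jetMatrix_mul hlen fun j => f (e j)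
        rw [hprod f, hprod fun i => UniqueFactorizationMonoid.radical (f i) ^ M] at h1
        refine h1.trans (mul_dvd_mul (hc ▸ dvd_mul_left _ _) ?_)
        exact Finset.prod_dvd_prod_of_subset _ _ _ fun i hi =>
          Finset.mem_erase.mpr ⟨fun h => hoB (h ▸ hi), Finset.mem_univ i⟩
      · have h0 : (jetMatrix w fun j => f (e j)).det ≠ 0 := fun h => hW (by rw [hc, h, mul_zero])
        have h1 := totalDegree_det_jetMatrix_add_le w (fun j => f (e j)) h0
        rw [Equiv.sum_comp e fun i : B => (f i).totalDegree,
          Finset.sum_coe_sort B fun i => (f i).totalDegree] at h1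
        have hc0 : C c ≠ (0 : MvPolynomial σ k) := fun h => hW (by rw [hc, h, zero_mul])
        rw [hc, totalDegree_mul_of_isDomain hc0 h0, totalDegree_C]
        omega)
  obtain ⟨h1, h2⟩ := hbd ∅ (Finset.disjoint_empty_right _)
    (by rw [Finset.union_empty, Finset.coe_univ, Set.image_univ])
    (by rw [Finset.card_empty, zero_add, Finset.coe_univ, Set.image_univ])
  have hprod : ∀ (S : Finset ι) (φ : ι → MvPolynomial σ k), (∀ i, φ i ≠ 0) →
      (∏ i ∈ S, φ i).totalDegree = ∑ i ∈ S, (φ i).totalDegree := by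
    intro S φ hφ
    induction S using Finset.induction_on with
    | empty => simp
    | insert i S hi ih =>
      rw [Finset.prod_insert hi, Finset.sum_insert hi, totalDegree_mul_of_isDomain (hφ i)
        (Finset.prod_ne_zero_iff.mpr fun i _ => hφ i), ih]
  have h3 := totalDegree_le_of_dvd_of_isDomain h1 (mul_ne_zero (mul_ne_zero hW hr) hH)
  rw [Finset.prod_empty, mul_one, hprod _ _ hne,
    totalDegree_mul_of_isDomain (mul_ne_zero hW hr) hH, totalDegree_mul_of_isDomain hW hr,
    Finset.prod_pow] at h3
  have h4 := totalDegree_pow (∏ i ∈ Finset.univ.erase o,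
    UniqueFactorizationMonoid.radical (f i)) M
  rw [hprod _ _ fun i => UniqueFactorizationMonoid.radical_ne_zero] at h4
  have h5 := Finset.add_sum_erase Finset.univ (fun i => (f i).totalDegree) (Finset.mem_univ o)
  simp only [Finset.sum_empty] at h2 h5
  exact ⟨M, hM, hMd, by omega⟩

end DegreeBound

section ReductionToCoprimeFamilies

variable {l : ℕ}

theorem radicalDegree_le_of_dvd {p q : MvPolynomial (Fin l) ℂ} (h : p ∣ q) (hq : q ≠ 0) :
    radicalDegree p ≤ radicalDegree q :=
  totalDegree_le_of_dvd_of_isDomain (UniqueFactorizationMonoid.radical_dvd_radical h hq)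
    UniqueFactorizationMonoid.radical_ne_zero

theorem dvd_of_radicalDegree_le_of_dvd {p q r : MvPolynomial (Fin l) ℂ} (h : p ∣ q) (hq : q ≠ 0)
    (hle : radicalDegree q ≤ radicalDegree p) (hr : Irreducible r) (hrq : r ∣ q) : r ∣ p := by
  have hp : p ≠ 0 := ne_zero_of_dvd_ne_zero hq h
  obtain ⟨c, hc⟩ := UniqueFactorizationMonoid.radical_dvd_radical h hq
  have hp0 : UniqueFactorizationMonoid.radical p ≠ 0 := UniqueFactorizationMonoid.radical_ne_zero
  have hq0 : UniqueFactorizationMonoid.radical q ≠ 0 := UniqueFactorizationMonoid.radical_ne_zero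
  have hc0 : c ≠ 0 := fun h0 => hq0 (by rw [hc, h0, mul_zero])
  have hdeg : c.totalDegree = 0 := by
    have := congrArg totalDegree hc
    rw [totalDegree_mul_of_isDomain hp0 hc0] at this
    unfold radicalDegree at hle
    omega
  rw [totalDegree_eq_zero_iff_eq_C] at hdeg
  have hunit : IsUnit c := by
    rw [hdeg]
    refine (isUnit_iff_ne_zero.mpr fun h0 => hc0 ?_).map C
    rw [hdeg, h0, C_0]
  rw [← UniqueFactorizationMonoid.dvd_radical_iff_of_irreducible hr hq, hc,
    hunit.dvd_mul_right] at hrq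
  exact hrq.trans UniqueFactorizationMonoid.radical_dvd_self

theorem one_le_radicalDegree {p : MvPolynomial (Fin l) ℂ} (hp : p ≠ 0)
    (hc : ¬ ∃ c, p = C c) : 1 ≤ radicalDegree p := by
  by_contra hlt
  have hdeg : (UniqueFactorizationMonoid.radical p).totalDegree = 0 := by
    unfold radicalDegree at hlt
    omega
  have hpu : ¬ IsUnit p := fun hu => hc (by
    obtain ⟨q, hq⟩ := hu.exists_right_inv
    have h1 := congrArg totalDegree hq
    rw [totalDegree_mul_of_isDomain hp (fun h => by simp [h] at hq), totalDegree_one] at h1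
    exact ⟨_, totalDegree_eq_zero_iff_eq_C.mp (by omega : p.totalDegree = 0)⟩)
  obtain ⟨r, hr, hrp⟩ := WfDvdMonoid.exists_irreducible_factor hpu hp
  rw [← UniqueFactorizationMonoid.dvd_radical_iff_of_irreducible hr hp,
    totalDegree_eq_zero_iff_eq_C.mp hdeg] at hrp
  refine hr.not_isUnit (isUnit_of_dvd_unit hrp ((isUnit_iff_ne_zero.mpr fun h0 => ?_).map C))
  have := totalDegree_eq_zero_iff_eq_C.mp hdeg
  rw [h0, C_0] at this
  exact UniqueFactorizationMonoid.radical_ne_zero this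

theorem two_le_spanDim {N : ℕ} {f : Fin N → MvPolynomial (Fin l) ℂ} (hne : ∀ i, f i ≠ 0)
    (hsim : ¬ ∀ i j, PolySimilar (f i) (f j)) : 2 ≤ spanDim f := by
  have hfin := FiniteDimensional.span_of_finite ℂ (Set.finite_range f)
  by_contra hlt
  have hle : Module.finrank ℂ (Submodule.span ℂ (Set.range f)) ≤ 1 := by
    unfold spanDim at hlt
    omega
  obtain ⟨v, hv⟩ := finrank_le_one_iff.mp hle
  have hv' : ∀ i, ∃ c : ℂ, c • (v : MvPolynomial (Fin l) ℂ) = f i := fun i => by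
    obtain ⟨c, hc⟩ := hv ⟨f i, Submodule.subset_span ⟨i, rfl⟩⟩
    exact ⟨c, congrArg Subtype.val hc⟩
  choose c hc using hv'
  have hc0 : ∀ i, c i ≠ 0 := fun i h => hne i (by rw [← hc i, h, zero_smul])
  refine hsim fun i j => ⟨c j / c i, div_ne_zero (hc0 j) (hc0 i), ?_⟩
  rw [← smul_eq_C_mul, ← hc i, ← hc j, smul_smul, div_mul_cancel₀ _ (hc0 i)]

theorem spanDim_mul_left {N : ℕ} {h : MvPolynomial (Fin l) ℂ} (hh : h ≠ 0)
    (g : Fin N → MvPolynomial (Fin l) ℂ) : spanDim (fun i => h * g i) = spanDim g := by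
  have hrange : Set.range (fun i => h * g i) = LinearMap.mulLeft ℂ h '' Set.range g := by
    rw [← Set.range_comp]
    rfl
  unfold spanDim
  rw [hrange, Submodule.span_image]
  exact (LinearEquiv.finrank_eq (Submodule.equivMapOfInjective (LinearMap.mulLeft ℂ h)
    (mul_right_injective₀ hh) _)).symm

theorem totalDegree_finset_gcd_mul_left {N : ℕ} {h : MvPolynomial (Fin l) ℂ} (hh : h ≠ 0)
    {g : Fin N → MvPolynomial (Fin l) ℂ} (hg : ∀ i, g i ≠ 0) {S : Finset (Fin N)}
    (hS : S.Nonempty) :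
    (S.gcd fun i => h * g i).totalDegree = h.totalDegree + (S.gcd g).totalDegree := by
  rw [totalDegree_eq_of_associated (Finset.gcd_mul_left' (s := S) (f := g) h),
    totalDegree_mul_of_isDomain hh (finset_gcd_ne_zero hg hS)]

theorem le_sum_radicalDegree_add_numConstants {n : ℕ}
    {f : Fin (n + 1) → MvPolynomial (Fin l) ℂ} (hne : ∀ i, f i ≠ 0) :
    n ≤ ∑ m : Fin n, radicalDegree (f m.castSucc) + numConstants f := by
  classical
  have h1 : (Finset.univ.filter fun m : Fin n => ∃ c, f m.castSucc = C c).card ≤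
      numConstants f := by
    unfold numConstants
    rw [← Finset.card_map Fin.castSuccEmb, ← Set.ncard_coe_finset]
    refine Set.ncard_le_ncard ?_ (Set.toFinite _)
    intro i hi
    obtain ⟨m, hm, rfl⟩ := Finset.mem_map.mp (Finset.mem_coe.mp hi)
    exact (Finset.mem_filter.mp hm).2
  have h2 : (Finset.univ.filter fun m : Fin n => ¬ ∃ c, f m.castSucc = C c).card ≤
      ∑ m : Fin n, radicalDegree (f m.castSucc) := by
    rw [Finset.card_eq_sum_ones]
    refine (Finset.sum_le_sum fun m hm => ?_).trans
      (Finset.sum_le_sum_of_subset (Finset.filter_subset _ _))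
    exact one_le_radicalDegree (hne _) (Finset.mem_filter.mp hm).2
  have h3 := Finset.card_filter_add_card_filter_not (s := (Finset.univ : Finset (Fin n)))
    (fun m : Fin n => ∃ c, f m.castSucc = C c)
  rw [Finset.card_univ, Fintype.card_fin] at h3
  omega

/-- A family whose greatest common divisor is not a unit loses some square-free degree when it is
divided by its greatest common divisor. -/
theorem exists_radicalDegree_lt_of_not_isUnit_gcd {n : ℕ}
    {g : Fin (n + 1) → MvPolynomial (Fin l) ℂ} {h : MvPolynomial (Fin l) ℂ}
    (hh : h ≠ 0) (hne : ∀ i, g i ≠ 0) (hsum : ∑ i, g i = 0)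
    (hcop : ∀ p, (∀ i, p ∣ g i) → IsUnit p) (hu : ¬ IsUnit h) :
    ∃ m : Fin n, radicalDegree (g m.castSucc) < radicalDegree (h * g m.castSucc) := by
  by_contra! hc
  obtain ⟨p, hp, hph⟩ := WfDvdMonoid.exists_irreducible_factor hu hh
  have hcast : ∀ m : Fin n, p ∣ g m.castSucc := fun m =>
    dvd_of_radicalDegree_le_of_dvd (dvd_mul_left _ _) (mul_ne_zero hh (hne _)) (hc m) hp
      (hph.mul_right _)
  refine hp.not_isUnit (hcop p fun i => ?_)
  refine Fin.lastCases ?_ hcast i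
  rw [Fin.sum_univ_castSucc] at hsum
  exact (dvd_add_right (Finset.dvd_sum fun m _ => hcast m)).mp (hsum ▸ dvd_zero p)

end ReductionToCoprimeFamilies

theorem mul_sub_half_le_of_le {M d R R' D e : ℕ} (hMd : M + 1 ≤ d) (hdR : d ≤ R + 1)
    (hD : 2 * D + M * (M + 1) ≤ 2 * e + 2 * (M * R')) :
    (D : ℝ) - e + M * (R - R') ≤ ((d : ℝ) - 1) * (R - (d : ℝ) / 2) := by
  obtain ⟨x, rfl⟩ := Nat.exists_eq_add_of_le hMd
  have hD' : 2 * (D : ℝ) + M * (M + 1) ≤ 2 * e + 2 * (M * R') := by exact_mod_cast hD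
  have hkey : 0 ≤ (x : ℝ) * (2 * R - 2 * M - 1 - x) := by
    rcases Nat.eq_zero_or_pos x with rfl | hx
    · simp
    · have h1 : (1 : ℝ) ≤ x := by exact_mod_cast hx
      have h2 : (M : ℝ) + 1 + x ≤ R + 1 := by exact_mod_cast hdR
      exact mul_nonneg (by positivity) (by linarith)
  push_cast
  linarith

theorem mainTheorem8 (l n : ℕ) (f : Fin (n + 1) → MvPolynomial (Fin l) ℂ)
    (hne : ∀ i, f i ≠ 0)
    (hsim : ¬ ∀ i j, PolySimilar (f i) (f j))
    (hsum : ∑ i, f i = 0)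
    (hgcd : ∀ S : Finset (Fin (n + 1)), S.Nonempty → ∑ i ∈ S, f i = 0 →
      (S.gcd f).totalDegree ≤ (f (Fin.last n)).totalDegree)
    (d' : ℕ) (hd : spanDim f ≤ d') (hd' : d' + numConstants f ≤ n + 1) :
    (((Finset.univ.sup fun m : Fin n => (f m.castSucc).totalDegree : ℕ) : ℝ)
          - ((f (Fin.last n)).totalDegree : ℝ)
        ≤ ((d' : ℝ) - 1)
          * ((∑ m : Fin n, (radicalDegree (f m.castSucc) : ℝ)) - (d' : ℝ) / 2)) ∧
    (((Finset.univ.sup fun m : Fin n => (f m.castSucc).totalDegree : ℕ) : ℝ)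
          - ((f (Fin.last n)).totalDegree : ℝ)
        = ((d' : ℝ) - 1)
          * ((∑ m : Fin n, (radicalDegree (f m.castSucc) : ℝ)) - (d' : ℝ) / 2) →
      Finset.univ.gcd f = 1) := by
  have hdim := two_le_spanDim hne hsim
  have hconst := le_sum_radicalDegree_add_numConstants hne
  set h := Finset.univ.gcd f with hh
  have hh0 : h ≠ 0 := finset_gcd_ne_zero hne Finset.univ_nonempty
  obtain ⟨g, hfg⟩ : ∃ g : Fin (n + 1) → MvPolynomial (Fin l) ℂ, f = fun i => h * g i := by
    choose g hg using fun i => Finset.gcd_dvd (f := f) (Finset.mem_univ i)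
    exact ⟨g, funext hg⟩
  have hfgi : ∀ i, f i = h * g i := fun i => congrFun hfg i
  have hg0 : ∀ i, g i ≠ 0 := fun i h0 => hne i (by rw [hfgi, h0, mul_zero])
  have hdeg : ∀ i, (f i).totalDegree = h.totalDegree + (g i).totalDegree := fun i => by
    rw [hfgi, totalDegree_mul_of_isDomain hh0 (hg0 i)]
  have hsum_iff : ∀ S : Finset (Fin (n + 1)), ∑ i ∈ S, f i = h * ∑ i ∈ S, g i := fun S => by
    rw [Finset.mul_sum]
    exact Finset.sum_congr rfl fun i _ => hfgi i
  have hgsum : ∑ i, g i = 0 := by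
    rw [hsum_iff] at hsum
    exact (mul_eq_zero.mp hsum).resolve_left hh0
  have hcop : ∀ p, (∀ i, p ∣ g i) → IsUnit p := by
    intro p hp
    have h1 : h * p ∣ h := Finset.dvd_gcd fun i _ => by
      rw [hfgi]
      exact mul_dvd_mul_left h (hp i)
    rw [← mul_one h, mul_assoc, mul_dvd_mul_iff_left hh0, one_mul] at h1
    exact isUnit_of_dvd_one h1
  have hspan : spanDim g = spanDim f := by
    rw [hfg]
    exact (spanDim_mul_left hh0 g).symm
  obtain ⟨M, hM, hMd, hbound⟩ := exists_totalDegree_bound (Fin.last n) hg0 hgsum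
    (by
      intro S hS hS0
      have h1 := hgcd S hS (by rw [hsum_iff, hS0, mul_zero])
      rw [hdeg, hfg, totalDegree_finset_gcd_mul_left hh0 hg0 hS] at h1
      omega)
    (hspan.symm ▸ hdim : 2 ≤ spanDim g)
  change M + 1 ≤ spanDim g at hMd
  rw [hspan] at hMd
  have hsumR : ∑ i ∈ Finset.univ.erase (Fin.last n),
      (UniqueFactorizationMonoid.radical (g i)).totalDegree =
        ∑ m : Fin n, radicalDegree (g m.castSucc) := by
    have h1 := Finset.add_sum_erase Finset.univ (fun i => radicalDegree (g i))
      (Finset.mem_univ (Fin.last n))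
    rw [Fin.sum_univ_castSucc, add_comm] at h1
    exact Nat.add_right_cancel h1
  rw [hsumR] at hbound
  have hsup : (Finset.univ.sup fun m : Fin n => (f m.castSucc).totalDegree) ≤
      h.totalDegree + Finset.univ.sup fun i => (g i).totalDegree := by
    refine Finset.sup_le fun m _ => ?_
    rw [hdeg]
    exact Nat.add_le_add_left
      (Finset.le_sup (f := fun i => (g i).totalDegree) (Finset.mem_univ m.castSucc)) _
  have hlast := hdeg (Fin.last n)
  have hR : ∀ m : Fin n, radicalDegree (g m.castSucc) ≤ radicalDegree (f m.castSucc) := fun m =>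
    radicalDegree_le_of_dvd ⟨h, by rw [hfgi, mul_comm]⟩ (hne _)
  have hRsum := Finset.sum_le_sum fun m (_ : m ∈ Finset.univ) => hR m
  have hmain := mul_sub_half_le_of_le (hMd.trans hd)
    (by omega : d' ≤ ∑ m : Fin n, radicalDegree (f m.castSucc) + 1)
    (D := Finset.univ.sup fun m : Fin n => (f m.castSucc).totalDegree)
    (R' := ∑ m : Fin n, radicalDegree (g m.castSucc))
    (e := (f (Fin.last n)).totalDegree) (by omega)
  have hRreal : ((∑ m : Fin n, radicalDegree (g m.castSucc) : ℕ) : ℝ) ≤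
      ((∑ m : Fin n, radicalDegree (f m.castSucc) : ℕ) : ℝ) := by exact_mod_cast hRsum
  rw [← Nat.cast_sum]
  have hMpos : (0 : ℝ) < M := by exact_mod_cast hM
  constructor
  · have := mul_nonneg hMpos.le (sub_nonneg.mpr hRreal)
    linarith
  · intro heq
    have hunit : IsUnit h := by
      by_contra hu
      obtain ⟨m, hm⟩ := exists_radicalDegree_lt_of_not_isUnit_gcd hh0 hg0 hgsum hcop hu
      rw [← hfgi] at hm
      have hlt : ((∑ m : Fin n, radicalDegree (g m.castSucc) : ℕ) : ℝ) <
          ((∑ m : Fin n, radicalDegree (f m.castSucc) : ℕ) : ℝ) := by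
        exact_mod_cast Finset.sum_lt_sum (fun m _ => hR m) ⟨m, Finset.mem_univ m, hm⟩
      have := mul_pos hMpos (sub_pos.mpr hlt)
      linarith
    rw [hh, ← Finset.normalize_gcd]
    exact normalize_eq_one.mpr hunit
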